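/- Let $n\ge 2$ and $n<m\le 2n$ be integers, and let $\mathbb{Z}_n(m)$ be the (finite, non-empty) set of $n\times n$ matrices with entries in $\{0,1\}$ and exactly $m$ entries equal to $1$. The trace norm $\|A\|_*$ of a matrix $A$ is the sum of its singular values; put \[\psi_n(m)=\min\{\|A\|_*: A\in\mathbb{Z}_n(m)\}.\] Call two $n\times n$ matrices equivalent if one is obtained from the other by permuting rows, permuting columns, and possibly transposing. (1) If $m$ is a prime, then $\psi_n(m)=\sqrt{m+\sqrt{2(m-1)}}$. Moreover, $m=2k+1$ is odd, and a matrix $A\in\mathbb{Z}_n(m)$ satisfies $\|A\|_*=\psi_n(m)$ if and only if $A$ is equivalent to the $n\times n$ matrix whose first row consists of $k+1$ ones followed by zeros, whose second row consists of $k$ ones followed by zeros, and whose other rows are zero. (2) If $m$ is not a prime, then $\psi_n(m)=\sqrt{m}$. Moreover, a matrix $A\in\mathbb{Z}_n(m)$ satisfies $\|A\|_*=\psi_n(m)$ if and only if there are positive integers $a,b\le n$ with $m=ab$ such that $A$ is equivalent to the $n\times n$ matrix with an $a\times b$ all-ones block in its upper left corner and zeros elsewhere. -/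

import Mathlib

/-- The trace norm of a matrix: the sum of its singular values. (`LinearMap.singularValues` lists
the singular values, with multiplicity, at the indices below the number of columns, and is zero
from there on.) -/
noncomputable def traceNorm {𝕜 : Type*} [RCLike 𝕜] {p q : ℕ} (A : Matrix (Fin p) (Fin q) 𝕜) : ℝ :=
  ∑ i ∈ Finset.range q, (Matrix.toEuclideanLin A).singularValues i

/-- The set of `n × n` matrices with entries in `{0, 1}` and with exactly `m` ones. -/
def zeroOneMatrices (n m : ℕ) : Set (Matrix (Fin n) (Fin n) ℝ) :=
  {A | (∀ i j, A i j = 0 ∨ A i j = 1) ∧ Set.ncard {x : Fin n × Fin n | A x.1 x.2 = 1} = m}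

/-- The minimum trace norm of an `n × n` matrix of zeros and ones with exactly `m` ones. -/
noncomputable def psi (n m : ℕ) : ℝ :=
  sInf (traceNorm '' zeroOneMatrices n m)

/-- Two square matrices of the same size are equivalent if one is obtained from the other by
permutations of rows, permutations of columns, and transposition. -/
def MatEquiv {n : ℕ} (A B : Matrix (Fin n) (Fin n) ℝ) : Prop :=
  ∃ σ τ : Equiv.Perm (Fin n), B = A.submatrix σ τ ∨ B = A.transpose.submatrix σ τ

/-- The `n × n` matrix with an `a × b` all-ones block in its upper left corner and zeros elsewhere
(for `a, b ≤ n`). -/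
def onesBlock (n a b : ℕ) : Matrix (Fin n) (Fin n) ℝ :=
  Matrix.of fun i j => if (i : ℕ) < a ∧ (j : ℕ) < b then 1 else 0

/-- The `n × n` matrix whose first row starts with `k + 1` ones, whose second row starts with `k`
ones, and whose other entries are zero (for `2 ≤ n` and `k + 1 ≤ n`). -/
def twoRowStep (n k : ℕ) : Matrix (Fin n) (Fin n) ℝ :=
  Matrix.of fun i j =>
    if ((i : ℕ) = 0 ∧ (j : ℕ) < k + 1) ∨ ((i : ℕ) = 1 ∧ (j : ℕ) < k) then 1 else 0

/-! Let `E` be the set of cells of `A` with entry 1, so `|E| = m`, and let `P` be the number of open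
pairs of `E`. The squares of the singular values sum to `tr(AᵀA) = m`. Their fourth powers sum to
`tr((AᵀA)²)`, which counts the ordered pairs of cells of `E` whose other two rectangle corners also
lie in `E`. Hence `m² - ∑ σ⁴ = P`. For nonnegative numbers, `2((∑ σ²)² - ∑ σ⁴) ≤ ((∑ σ)² - ∑ σ²)²`,
with equality if at most two are nonzero, so `‖A‖_* ≥ √(m + √(2P))`, with equality in rank at most 2
(`sqrt_card_le_traceNorm`, `traceNorm_eq_sqrt_card`).

The rest is the combinatorics of `P`. If `P = 0`, then `E` is a combinatorial rectangle
(`eq_product_of_openPairs_eq_empty`). Otherwise `P ≥ m - 1`, and equality forces a rectangle with a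
side 2, less one cell (`card_le_card_openPairs_add_one`, `exists_of_card_openPairs_add_one_le`). A
composite `m ≤ 2n` is the area of a rectangle that fits. A prime `m > n` is not, and the rectangle
less one cell is then optimal. -/

/-! ### Open pairs of a finite set of cells. -/

section Combinatorics

variable {α β : Type*} [Fintype α] [Fintype β] [DecidableEq α] [DecidableEq β]

/-- The ordered pairs of cells of `E` which are opposite corners of a rectangle that is not
contained in `E`. -/
def openPairs (E : Finset (α × β)) : Finset ((α × β) × (α × β)) :=
  Finset.univ.filter fun x =>
    x.1 ∈ E ∧ x.2 ∈ E ∧ ¬ ((x.1.1, x.2.2) ∈ E ∧ (x.2.1, x.1.2) ∈ E)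

theorem mem_openPairs {E : Finset (α × β)} {x : (α × β) × (α × β)} :
    x ∈ openPairs E ↔ x.1 ∈ E ∧ x.2 ∈ E ∧ ¬ ((x.1.1, x.2.2) ∈ E ∧ (x.2.1, x.1.2) ∈ E) := by
  simp [openPairs]

theorem eq_product_of_openPairs_eq_empty {E : Finset (α × β)} (h : openPairs E = ∅) :
    E = E.image Prod.fst ×ˢ E.image Prod.snd := by
  ext ⟨i, j⟩
  simp only [Finset.mem_product, Finset.mem_image, Prod.exists, exists_and_right, exists_eq_right]
  constructor
  · exact fun hij => ⟨⟨j, hij⟩, ⟨i, hij⟩⟩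
  · rintro ⟨⟨j', hj⟩, ⟨i', hi⟩⟩
    by_contra hij
    have : ((i, j'), (i', j)) ∈ openPairs E := mem_openPairs.2 ⟨hj, hi, fun h => hij h.1⟩
    simp [h] at this

theorem openPairs_product (R : Finset α) (C : Finset β) : openPairs (R ×ˢ C) = ∅ := by
  ext x
  simp only [mem_openPairs, Finset.mem_product, Finset.notMem_empty, iff_false]
  tauto

/-- The rows of `E` that contain every nonempty column. -/
def fullRows (E : Finset (α × β)) : Finset α :=
  (E.image Prod.fst).filter fun i => ∀ j ∈ E.image Prod.snd, (i, j) ∈ E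

/-- The columns of `E` that contain every nonempty row. -/
def fullCols (E : Finset (α × β)) : Finset β :=
  (E.image Prod.snd).filter fun j => ∀ i ∈ E.image Prod.fst, (i, j) ∈ E

/-- The nonempty rows of `E` that are not full. -/
def partRows (E : Finset (α × β)) : Finset α := E.image Prod.fst \ fullRows E

/-- The nonempty columns of `E` that are not full. -/
def partCols (E : Finset (α × β)) : Finset β := E.image Prod.snd \ fullCols E

variable {E : Finset (α × β)}

theorem mem_fullRows {i : α} :
    i ∈ fullRows E ↔ (∃ j, (i, j) ∈ E) ∧ ∀ i' j, (i', j) ∈ E → (i, j) ∈ E := by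
  simp [fullRows]
  grind

theorem mem_fullCols {j : β} :
    j ∈ fullCols E ↔ (∃ i, (i, j) ∈ E) ∧ ∀ i j', (i, j') ∈ E → (i, j) ∈ E := by
  simp [fullCols]

theorem mem_partRows {i : α} :
    i ∈ partRows E ↔ (∃ j, (i, j) ∈ E) ∧ ∃ i' j, (i', j) ∈ E ∧ (i, j) ∉ E := by
  simp [partRows, mem_fullRows]
  grind

theorem mem_partCols {j : β} :
    j ∈ partCols E ↔ (∃ i, (i, j) ∈ E) ∧ ∃ i j', (i, j') ∈ E ∧ (i, j) ∉ E := by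
  simp [partCols, mem_fullCols]
  grind

theorem exists_partCols_of_mem_partRows {i : α} (hi : i ∈ partRows E) :
    ∃ j ∈ partCols E, (i, j) ∉ E := by
  obtain ⟨⟨j, hj⟩, i', j', h1, h2⟩ := mem_partRows.1 hi
  exact ⟨j', mem_partCols.2 ⟨⟨i', h1⟩, i, j, hj, h2⟩, h2⟩

theorem exists_partRows_of_mem_partCols {j : β} (hj : j ∈ partCols E) :
    ∃ i ∈ partRows E, (i, j) ∉ E := by
  obtain ⟨⟨i, hi⟩, i', j', h1, h2⟩ := mem_partCols.1 hj
  exact ⟨i', mem_partRows.2 ⟨⟨j', h1⟩, i, j, hi, h2⟩, h2⟩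

/-- If there is no full row or no full column, then every cell of `E` lies in an open pair. -/
theorem card_le_card_openPairs (h : fullRows E = ∅ ∨ fullCols E = ∅) :
    E.card ≤ (openPairs E).card := by
  have : E ⊆ (openPairs E).image Prod.fst := by
    rintro ⟨i, j⟩ hij
    rw [Finset.mem_image]
    rcases h with h | h
    -- If row `i` misses a nonempty column `j'`, then `(i, j)` and any cell of `E` in column `j'`
    -- form an open pair.
    · have : i ∉ fullRows E := by simp [h]
      rw [mem_fullRows] at this
      push Not at this
      obtain ⟨i', j', h1, h2⟩ := this ⟨j, hij⟩
      exact ⟨((i, j), (i', j')), mem_openPairs.2 ⟨hij, h1, fun h => h2 h.1⟩, rfl⟩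
    · have : j ∉ fullCols E := by simp [h]
      rw [mem_fullCols] at this
      push Not at this
      obtain ⟨i', j', h1, h2⟩ := this ⟨i, hij⟩
      exact ⟨((i, j), (i', j')), mem_openPairs.2 ⟨hij, h1, fun h => h2 h.2⟩, rfl⟩
  exact (Finset.card_le_card this).trans Finset.card_image_le

/-- The cells of `E` in its part rows and part columns. -/
def partCells (E : Finset (α × β)) : Finset (α × β) := (partRows E ×ˢ partCols E) ∩ E

/-- The cells outside `E` in its part rows and part columns. -/
def partHoles (E : Finset (α × β)) : Finset (α × β) := (partRows E ×ˢ partCols E) \ E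

theorem card_partCells_add_card_partHoles :
    (partCells E).card + (partHoles E).card = (partRows E).card * (partCols E).card := by
  rw [partCells, partHoles, Finset.card_inter_add_card_sdiff, Finset.card_product]

/-- Each part row contains a hole, and that hole lies in a part column. -/
theorem card_partRows_le : (partRows E).card ≤ (partHoles E).card := by
  have : partRows E ⊆ (partHoles E).image Prod.fst := fun i hi => by
    obtain ⟨j, hj, hij⟩ := exists_partCols_of_mem_partRows hi
    exact Finset.mem_image.2 ⟨(i, j), by simp [partHoles, hi, hj, hij], rfl⟩
  exact (Finset.card_le_card this).trans Finset.card_image_le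

theorem card_partCols_le : (partCols E).card ≤ (partHoles E).card := by
  have : partCols E ⊆ (partHoles E).image Prod.snd := fun j hj => by
    obtain ⟨i, hi, hij⟩ := exists_partRows_of_mem_partCols hj
    exact Finset.mem_image.2 ⟨(i, j), by simp [partHoles, hi, hj, hij], rfl⟩
  exact (Finset.card_le_card this).trans Finset.card_image_le

theorem mem_iff_fullRows_fullCols (i : α) (j : β) : (i, j) ∈ E ↔
    (i ∈ fullRows E ∧ j ∈ fullCols E) ∨ (i ∈ fullRows E ∧ j ∈ partCols E) ∨
      (i ∈ partRows E ∧ j ∈ fullCols E) ∨ (i, j) ∈ partCells E := by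
  simp only [mem_fullRows, mem_fullCols, mem_partRows, mem_partCols, partCells,
    Finset.mem_inter, Finset.mem_product]
  grind

set_option linter.unusedSectionVars false in
theorem disjoint_fullRows_partRows : Disjoint (fullRows E) (partRows E) :=
  Finset.disjoint_sdiff

set_option linter.unusedSectionVars false in
theorem disjoint_fullCols_partCols : Disjoint (fullCols E) (partCols E) :=
  Finset.disjoint_sdiff

theorem card_eq_fullRows_fullCols : E.card =
    (fullRows E).card * (fullCols E).card + (fullRows E).card * (partCols E).card +
      (partRows E).card * (fullCols E).card + (partCells E).card := by
  have hr := Finset.disjoint_left.1 (disjoint_fullRows_partRows (E := E))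
  have hc := Finset.disjoint_left.1 (disjoint_fullCols_partCols (E := E))
  have h : E = ((fullRows E ×ˢ fullCols E ∪ fullRows E ×ˢ partCols E) ∪
      partRows E ×ˢ fullCols E) ∪ partCells E := by
    ext ⟨i, j⟩
    rw [mem_iff_fullRows_fullCols]
    simp only [Finset.mem_union, Finset.mem_product]
    tauto
  conv_lhs => rw [h]
  rw [Finset.card_union_of_disjoint, Finset.card_union_of_disjoint,
    Finset.card_union_of_disjoint, Finset.card_product, Finset.card_product, Finset.card_product]
  all_goals
    rw [Finset.disjoint_left]
    rintro ⟨i, j⟩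
    simp only [Finset.mem_union, Finset.mem_product, partCells, Finset.mem_inter]
    have := @hr i
    have := @hc j
    tauto

/-- The open pairs that start in a full row, end in a full column and span a hole. -/
theorem card_openPairs_fullRows :
    (fullRows E).card * (fullCols E).card * (partHoles E).card ≤
      ((openPairs E).filter fun x => x.1.1 ∈ fullRows E).card := by
  rw [← Finset.card_product, ← Finset.card_product]
  refine Finset.card_le_card_of_injOn (fun x => ((x.1.1, x.2.2), (x.2.1, x.1.2))) ?_ ?_
  · rintro ⟨⟨i, j⟩, i', j'⟩ h
    simp only [partHoles, Finset.coe_product, Set.mem_prod, Finset.mem_coe, Finset.mem_sdiff,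
      Finset.mem_product] at h
    have h1 := mem_iff_fullRows_fullCols (E := E) i j'
    have h2 := mem_iff_fullRows_fullCols (E := E) i' j
    simp only [Finset.mem_coe, Finset.mem_filter, mem_openPairs]
    tauto
  · rintro ⟨⟨i, j⟩, i', j'⟩ - ⟨⟨k, l⟩, k', l'⟩ - h
    simp only [Prod.mk.injEq] at h ⊢
    tauto

/-- These are the pairs counted in `card_openPairs_fullRows`, with their two cells interchanged. -/
theorem card_openPairs_fullCols :
    (fullRows E).card * (fullCols E).card * (partHoles E).card ≤
      ((openPairs E).filter fun x => x.1.1 ∈ partRows E ∧ x.1.2 ∈ fullCols E).card := by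
  rw [← Finset.card_product, ← Finset.card_product]
  refine Finset.card_le_card_of_injOn (fun x => ((x.2.1, x.1.2), (x.1.1, x.2.2))) ?_ ?_
  · rintro ⟨⟨i, j⟩, i', j'⟩ h
    simp only [partHoles, Finset.coe_product, Set.mem_prod, Finset.mem_coe, Finset.mem_sdiff,
      Finset.mem_product] at h
    have h1 := mem_iff_fullRows_fullCols (E := E) i j'
    have h2 := mem_iff_fullRows_fullCols (E := E) i' j
    simp only [Finset.mem_coe, Finset.mem_filter, mem_openPairs]
    tauto
  · rintro ⟨⟨i, j⟩, i', j'⟩ - ⟨⟨k, l⟩, k', l'⟩ - h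
    simp only [Prod.mk.injEq] at h ⊢
    tauto

/-- The row of a part cell misses some part column `j'`. The cell `(i₁, j')` of the full row `i₁`
completes an open pair. -/
theorem card_openPairs_partCells_fullRows {i₁ : α} (hi₁ : i₁ ∈ fullRows E) :
    (partCells E).card ≤ ((openPairs E).filter fun x => x.1 ∈ partCells E ∧
      x.2.1 ∈ fullRows E).card := by
  refine Finset.card_le_card_of_surjOn Prod.fst ?_
  rintro ⟨i, j⟩ h
  have h' : (i, j) ∈ partCells E := h
  have hE : (i, j) ∈ E := (Finset.mem_inter.1 h').2
  have hi : i ∈ partRows E := (Finset.mem_product.1 (Finset.mem_inter.1 h').1).1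
  obtain ⟨j', hj', hij'⟩ := exists_partCols_of_mem_partRows hi
  have h1 : (i₁, j') ∈ E := (mem_iff_fullRows_fullCols _ _).2 (by tauto)
  refine ⟨((i, j), (i₁, j')), ?_, rfl⟩
  simp only [Finset.mem_coe, Finset.mem_filter, mem_openPairs]
  tauto

theorem card_openPairs_partCells_fullCols {j₁ : β} (hj₁ : j₁ ∈ fullCols E) :
    (partCells E).card ≤ ((openPairs E).filter fun x => x.1 ∈ partCells E ∧
      x.2.1 ∈ partRows E).card := by
  refine Finset.card_le_card_of_surjOn Prod.fst ?_
  rintro ⟨i, j⟩ h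
  have h' : (i, j) ∈ partCells E := h
  have hE : (i, j) ∈ E := (Finset.mem_inter.1 h').2
  have hj : j ∈ partCols E := (Finset.mem_product.1 (Finset.mem_inter.1 h').1).2
  obtain ⟨i', hi', hij'⟩ := exists_partRows_of_mem_partCols hj
  have h1 : (i', j₁) ∈ E := (mem_iff_fullRows_fullCols _ _).2 (by tauto)
  refine ⟨((i, j), (i', j₁)), ?_, rfl⟩
  simp only [Finset.mem_coe, Finset.mem_filter, mem_openPairs]
  tauto

/-- The four families of open pairs counted above are disjoint: the kinds of row and column of the
first cell, and for part cells the kind of row of the second, tell them apart. -/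
theorem two_mul_card_le_card_openPairs {i₁ : α} (hi₁ : i₁ ∈ fullRows E) {j₁ : β}
    (hj₁ : j₁ ∈ fullCols E) :
    2 * ((fullRows E).card * (fullCols E).card * (partHoles E).card) + 2 * (partCells E).card ≤
      (openPairs E).card := by
  have hr := Finset.disjoint_left.1 (disjoint_fullRows_partRows (E := E))
  have hc := Finset.disjoint_left.1 (disjoint_fullCols_partCols (E := E))
  have key : ((openPairs E).filter fun x => x.1.1 ∈ fullRows E).card +
      ((openPairs E).filter fun x => x.1.1 ∈ partRows E ∧ x.1.2 ∈ fullCols E).card +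
      ((openPairs E).filter fun x => x.1 ∈ partCells E ∧ x.2.1 ∈ fullRows E).card +
      ((openPairs E).filter fun x => x.1 ∈ partCells E ∧ x.2.1 ∈ partRows E).card ≤
      (openPairs E).card := by
    rw [← Finset.card_union_of_disjoint, ← Finset.card_union_of_disjoint,
      ← Finset.card_union_of_disjoint]
    · refine Finset.card_le_card ?_
      intro x
      simp only [Finset.mem_union, Finset.mem_filter]
      tauto
    all_goals
      rw [Finset.disjoint_left]
      rintro ⟨⟨i, j⟩, i', j'⟩
      simp only [Finset.mem_union, Finset.mem_filter, partCells, Finset.mem_inter,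
        Finset.mem_product]
      have := @hr i
      have := @hr i'
      have := @hc j
      tauto
  have := card_openPairs_fullRows (E := E)
  have := card_openPairs_fullCols (E := E)
  have := card_openPairs_partCells_fullRows hi₁
  have := card_openPairs_partCells_fullCols hj₁
  omega

/-- A missing corner of an open pair has both its row and its column nonempty and not full. -/
theorem partHoles_nonempty (h : (openPairs E).Nonempty) : (partHoles E).Nonempty := by
  obtain ⟨⟨⟨i, j⟩, i', j'⟩, hx⟩ := h
  simp only [mem_openPairs] at hx
  obtain ⟨h1, h2, h3⟩ := hx
  by_cases h4 : (i, j') ∈ E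
  · refine ⟨(i', j), ?_⟩
    simp only [partHoles, Finset.mem_sdiff, Finset.mem_product, mem_partRows, mem_partCols]
    grind
  · refine ⟨(i, j'), ?_⟩
    simp only [partHoles, Finset.mem_sdiff, Finset.mem_product, mem_partRows, mem_partCols]
    grind

/-- The number of open pairs in terms of the numbers of full and part rows and columns. -/
theorem card_sub_one_add_le_card_openPairs {i₁ : α} (hi₁ : i₁ ∈ fullRows E) {j₁ : β}
    (hj₁ : j₁ ∈ fullCols E) :
    (E.card : ℤ) - 1 + (((fullRows E).card * (fullCols E).card - 1) * ((partHoles E).card - 1) +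
      (partHoles E).card * (((fullRows E).card - 1) * ((fullCols E).card - 1)) +
      (fullRows E).card * ((partHoles E).card - (partCols E).card) +
      (fullCols E).card * ((partHoles E).card - (partRows E).card) + (partCells E).card)
      ≤ (openPairs E).card := by
  -- With `p`, `q` full rows and columns, `s`, `t` part ones, `b` part cells and `z` holes, `|E| =
  -- pq + pt + sq + b` and `P ≥ 2pqz + 2b`. The bracket is `2pqz + 2b - |E| + 1`, grouped so that
  -- each summand is nonnegative once `p, q, z ≥ 1` and `s, t ≤ z`.
  have h1 := card_eq_fullRows_fullCols (E := E)
  have h2 := two_mul_card_le_card_openPairs hi₁ hj₁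
  zify at h1 h2
  linarith

theorem card_le_card_openPairs_add_one (h : (openPairs E).Nonempty) :
    E.card ≤ (openPairs E).card + 1 := by
  by_cases h0 : fullRows E = ∅ ∨ fullCols E = ∅
  · exact (card_le_card_openPairs h0).trans (Nat.le_succ _)
  push Not at h0
  obtain ⟨⟨i₁, hi₁⟩, ⟨j₁, hj₁⟩⟩ := h0
  have hp : (1 : ℤ) ≤ (fullRows E).card := by exact_mod_cast Finset.card_pos.2 ⟨i₁, hi₁⟩
  have hq : (1 : ℤ) ≤ (fullCols E).card := by exact_mod_cast Finset.card_pos.2 ⟨j₁, hj₁⟩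
  have hz : (1 : ℤ) ≤ (partHoles E).card := by
    exact_mod_cast Finset.card_pos.2 (partHoles_nonempty h)
  have hs : ((partRows E).card : ℤ) ≤ (partHoles E).card := by exact_mod_cast card_partRows_le
  have ht : ((partCols E).card : ℤ) ≤ (partHoles E).card := by exact_mod_cast card_partCols_le
  have hb : (0 : ℤ) ≤ (partCells E).card := by positivity
  have key := card_sub_one_add_le_card_openPairs hi₁ hj₁
  have h1 := mul_nonneg (show (0 : ℤ) ≤ (fullRows E).card * (fullCols E).card - 1 by nlinarith)
    (sub_nonneg.2 hz)
  have h2 := mul_nonneg (sub_nonneg.2 hp) (sub_nonneg.2 hq)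
  have h3 := mul_nonneg (show (0 : ℤ) ≤ (partHoles E).card by omega) h2
  have h4 := mul_nonneg (show (0 : ℤ) ≤ (fullRows E).card by omega) (sub_nonneg.2 ht)
  have h5 := mul_nonneg (show (0 : ℤ) ≤ (fullCols E).card by omega) (sub_nonneg.2 hs)
  have : (E.card : ℤ) ≤ (openPairs E).card + 1 := by linarith
  exact_mod_cast this

/-- A set with the fewest open pairs is a rectangle with one side `2` without one cell. -/
theorem exists_of_card_openPairs_add_one_le (h : (openPairs E).Nonempty)
    (hE : (openPairs E).card + 1 ≤ E.card) :
    ∃ (R : Finset α) (C : Finset β) (i₀ : α) (j₀ : β), i₀ ∉ R ∧ j₀ ∉ C ∧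
      (R.card = 1 ∨ C.card = 1) ∧
      ∀ i j, (i, j) ∈ E ↔ (i ∈ R ∧ j ∈ C) ∨ (i ∈ R ∧ j = j₀) ∨ (i = i₀ ∧ j ∈ C) := by
  by_cases h0 : fullRows E = ∅ ∨ fullCols E = ∅
  · have := card_le_card_openPairs h0
    omega
  push Not at h0
  obtain ⟨⟨i₁, hi₁⟩, ⟨j₁, hj₁⟩⟩ := h0
  have hp : (1 : ℤ) ≤ (fullRows E).card := by exact_mod_cast Finset.card_pos.2 ⟨i₁, hi₁⟩
  have hq : (1 : ℤ) ≤ (fullCols E).card := by exact_mod_cast Finset.card_pos.2 ⟨j₁, hj₁⟩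
  have hz : (1 : ℤ) ≤ (partHoles E).card := by
    exact_mod_cast Finset.card_pos.2 (partHoles_nonempty h)
  have hs : ((partRows E).card : ℤ) ≤ (partHoles E).card := by exact_mod_cast card_partRows_le
  have ht : ((partCols E).card : ℤ) ≤ (partHoles E).card := by exact_mod_cast card_partCols_le
  have hb : (0 : ℤ) ≤ (partCells E).card := by positivity
  have hbz : ((partCells E).card : ℤ) + (partHoles E).card =
      (partRows E).card * (partCols E).card := by
    exact_mod_cast card_partCells_add_card_partHoles
  have key := card_sub_one_add_le_card_openPairs hi₁ hj₁
  have h1 := mul_nonneg (show (0 : ℤ) ≤ (fullRows E).card * (fullCols E).card - 1 by nlinarith)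
    (sub_nonneg.2 hz)
  have h2 := mul_nonneg (sub_nonneg.2 hp) (sub_nonneg.2 hq)
  have h3 := mul_nonneg (show (0 : ℤ) ≤ (partHoles E).card by omega) h2
  have h4 := mul_nonneg (show (0 : ℤ) ≤ (fullRows E).card by omega) (sub_nonneg.2 ht)
  have h5 := mul_nonneg (show (0 : ℤ) ≤ (fullCols E).card by omega) (sub_nonneg.2 hs)
  have hE' : ((openPairs E).card : ℤ) + 1 ≤ E.card := by exact_mod_cast hE
  -- The nonnegative summands now have sum at most zero, so each of them vanishes.
  have e0 : ((partCells E).card : ℤ) = 0 := by linarith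
  have e4 : ((partHoles E).card : ℤ) = (partCols E).card := by
    have : ((fullRows E).card : ℤ) * ((partHoles E).card - (partCols E).card) = 0 := by linarith
    rcases mul_eq_zero.1 this with h | h <;> omega
  have e5 : ((partHoles E).card : ℤ) = (partRows E).card := by
    have : ((fullCols E).card : ℤ) * ((partHoles E).card - (partRows E).card) = 0 := by linarith
    rcases mul_eq_zero.1 this with h | h <;> omega
  -- Here `st = b + z` becomes `z² = z`, and `z ≥ 1`.
  have ez : ((partHoles E).card : ℤ) = 1 := by
    rw [e0, ← e4, ← e5] at hbz
    nlinarith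
  have e3 : ((partHoles E).card : ℤ) * (((fullRows E).card - 1) * ((fullCols E).card - 1)) = 0 := by
    linarith
  rw [ez, one_mul] at e3
  obtain ⟨i₀, hi₀⟩ := Finset.card_eq_one.1 (show (partRows E).card = 1 by omega)
  obtain ⟨j₀, hj₀⟩ := Finset.card_eq_one.1 (show (partCols E).card = 1 by omega)
  have hcell : partCells E = ∅ := Finset.card_eq_zero.1 (by omega)
  refine ⟨fullRows E, fullCols E, i₀, j₀, fun h' => Finset.disjoint_left.1
    disjoint_fullRows_partRows h' (by simp [hi₀]), fun h' => Finset.disjoint_left.1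
    disjoint_fullCols_partCols h' (by simp [hj₀]), ?_, fun i j => ?_⟩
  · rcases mul_eq_zero.1 e3 with h | h
    · left; omega
    · right; omega
  · rw [mem_iff_fullRows_fullCols, hcell, hi₀, hj₀]
    simp

end Combinatorics

/-! ### An inequality between power sums. -/

section PowerSums

/-- Expanded over pairs, the second claim reads `4 ∑_{i<j} (x i * x j)² ≤ (2 ∑_{i<j} x i * x j)²`: a
sum of squares of nonnegative numbers is at most the square of their sum. The first claim feeds the
induction and later allows a square root to be taken. -/
theorem sum_pow_four_inequality {ι : Type*} (s : Finset ι) (x : ι → ℝ) (hx : ∀ i ∈ s, 0 ≤ x i) :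
    ∑ i ∈ s, x i ^ 2 ≤ (∑ i ∈ s, x i) ^ 2 ∧
    2 * ((∑ i ∈ s, x i ^ 2) ^ 2 - ∑ i ∈ s, x i ^ 4) ≤
      ((∑ i ∈ s, x i) ^ 2 - ∑ i ∈ s, x i ^ 2) ^ 2 := by
  classical
  induction s using Finset.induction_on with
  | empty => simp
  | insert a s ha ih =>
    obtain ⟨h1, h2⟩ := ih fun i hi => hx i (Finset.mem_insert_of_mem hi)
    have h0 : 0 ≤ ∑ i ∈ s, x i := Finset.sum_nonneg fun i hi => hx i (Finset.mem_insert_of_mem hi)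
    have hxa := hx a (Finset.mem_insert_self _ _)
    simp only [Finset.sum_insert ha]
    generalize ∑ i ∈ s, x i = p at *
    generalize ∑ i ∈ s, x i ^ 2 = q at *
    generalize ∑ i ∈ s, x i ^ 4 = r at *
    generalize x a = y at *
    have h3 := mul_nonneg (mul_nonneg hxa h0) (sub_nonneg.2 h1)
    have h4 := mul_nonneg (sq_nonneg y) (sub_nonneg.2 h1)
    have h5 := mul_nonneg hxa h0
    constructor <;> nlinarith

end PowerSums

/-! ### Singular values, traces and the trace norm. -/

section TraceNorm

variable {n : ℕ}

theorem adjoint_comp_self_toEuclideanLin (A : Matrix (Fin n) (Fin n) ℝ) :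
    (Matrix.toEuclideanLin A).adjoint ∘ₗ Matrix.toEuclideanLin A =
      Matrix.toEuclideanLin (A.transpose * A) := by
  rw [← Matrix.toEuclideanLin_conjTranspose_eq_adjoint, Matrix.conjTranspose_eq_transpose_of_trivial]
  ext x i
  simp [Matrix.toLpLin_apply, Matrix.mulVec_mulVec]

theorem toEuclideanLin_eq_toLin_basisFun (A : Matrix (Fin n) (Fin n) ℝ) :
    Matrix.toEuclideanLin A =
      Matrix.toLin (PiLp.basisFun 2 ℝ (Fin n)) (PiLp.basisFun 2 ℝ (Fin n)) A :=
  DFunLike.congr_fun (Matrix.toLpLin_eq_toLin 2 2) A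

theorem charpoly_toEuclideanLin (A : Matrix (Fin n) (Fin n) ℝ) :
    (Matrix.toEuclideanLin A).charpoly = A.charpoly := by
  rw [toEuclideanLin_eq_toLin_basisFun, Matrix.charpoly_toLin]

theorem trace_toEuclideanLin (A : Matrix (Fin n) (Fin n) ℝ) :
    LinearMap.trace ℝ _ (Matrix.toEuclideanLin A) = A.trace := by
  rw [toEuclideanLin_eq_toLin_basisFun, Matrix.trace_toLin_eq]

theorem LinearMap.IsSymmetric.trace_comp_self_eq_sum_eigenvalues_sq {E : Type*}
    [NormedAddCommGroup E] [InnerProductSpace ℝ E] [FiniteDimensional ℝ E] {T : E →ₗ[ℝ] E}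
    (hT : T.IsSymmetric) (hn : Module.finrank ℝ E = n) :
    LinearMap.trace ℝ E (T ∘ₗ T) = ∑ i, hT.eigenvalues hn i ^ 2 := by
  rw [LinearMap.trace_eq_matrix_trace ℝ (hT.eigenvectorBasis hn).toBasis,
    LinearMap.toMatrix_comp _ (hT.eigenvectorBasis hn).toBasis, hT.toMatrix_eigenvectorBasis,
    Matrix.diagonal_mul_diagonal, Matrix.trace_diagonal]
  simp [sq]

section SingularValues

variable {E F : Type*} [NormedAddCommGroup E] [InnerProductSpace ℝ E] [FiniteDimensional ℝ E]
  [NormedAddCommGroup F] [InnerProductSpace ℝ F] [FiniteDimensional ℝ F]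

theorem LinearMap.roots_charpoly_adjoint_comp_self (T : E →ₗ[ℝ] F)
    (hn : Module.finrank ℝ E = n) :
    (T.adjoint ∘ₗ T).charpoly.roots =
      (Finset.univ : Finset (Fin n)).val.map fun i : Fin n => T.singularValues i ^ 2 := by
  rw [T.isSymmetric_adjoint_comp_self.roots_charpoly_eq_eigenvalues hn]
  refine Multiset.map_congr rfl fun i _ => ?_
  rw [T.sq_singularValues_fin hn]
  rfl

theorem LinearMap.trace_adjoint_comp_self (T : E →ₗ[ℝ] F) (hn : Module.finrank ℝ E = n) :
    LinearMap.trace ℝ E (T.adjoint ∘ₗ T) = ∑ i ∈ Finset.range n, T.singularValues i ^ 2 := by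
  rw [T.isSymmetric_adjoint_comp_self.trace_eq_sum_eigenvalues hn, Finset.sum_range,
    RCLike.ofReal_real_eq_id, id_eq]
  exact Finset.sum_congr rfl fun i _ => (T.sq_singularValues_fin hn i).symm

theorem LinearMap.trace_sq_adjoint_comp_self (T : E →ₗ[ℝ] F) (hn : Module.finrank ℝ E = n) :
    LinearMap.trace ℝ E ((T.adjoint ∘ₗ T) ∘ₗ (T.adjoint ∘ₗ T)) =
      ∑ i ∈ Finset.range n, T.singularValues i ^ 4 := by
  rw [T.isSymmetric_adjoint_comp_self.trace_comp_self_eq_sum_eigenvalues_sq hn, Finset.sum_range]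
  refine Finset.sum_congr rfl fun i _ => ?_
  rw [← T.sq_singularValues_fin hn, ← pow_mul]

end SingularValues

theorem roots_charpoly_transpose_mul_self (A : Matrix (Fin n) (Fin n) ℝ) :
    (A.transpose * A).charpoly.roots = (Finset.univ : Finset (Fin n)).val.map
      fun i : Fin n => (Matrix.toEuclideanLin A).singularValues i ^ 2 := by
  rw [← charpoly_toEuclideanLin, ← adjoint_comp_self_toEuclideanLin,
    LinearMap.roots_charpoly_adjoint_comp_self _ finrank_euclideanSpace_fin]

theorem traceNorm_eq_sum_fin (A : Matrix (Fin n) (Fin n) ℝ) :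
    traceNorm A = ∑ i : Fin n, (Matrix.toEuclideanLin A).singularValues i :=
  Finset.sum_range _

/-- This makes the trace norm a function of the characteristic polynomial of `AᵀA`, whence its
invariance under transposition and permutations. -/
theorem traceNorm_eq_sum_sqrt_roots (A : Matrix (Fin n) (Fin n) ℝ) :
    traceNorm A = ((A.transpose * A).charpoly.roots.map Real.sqrt).sum := by
  rw [roots_charpoly_transpose_mul_self, Multiset.map_map, traceNorm_eq_sum_fin]
  refine congrArg Multiset.sum (Multiset.map_congr rfl fun i _ => ?_)
  simp [Real.sqrt_sq (LinearMap.singularValues_nonneg _ _)]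

theorem sum_sq_singularValues (A : Matrix (Fin n) (Fin n) ℝ) :
    ∑ i ∈ Finset.range n, (Matrix.toEuclideanLin A).singularValues i ^ 2 =
      (A.transpose * A).trace := by
  rw [← trace_toEuclideanLin, ← adjoint_comp_self_toEuclideanLin,
    LinearMap.trace_adjoint_comp_self _ finrank_euclideanSpace_fin]

theorem sum_pow_four_singularValues (A : Matrix (Fin n) (Fin n) ℝ) :
    ∑ i ∈ Finset.range n, (Matrix.toEuclideanLin A).singularValues i ^ 4 =
      (A.transpose * A * (A.transpose * A)).trace := by
  have h : Matrix.toEuclideanLin (A.transpose * A * (A.transpose * A)) =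
      Matrix.toEuclideanLin (A.transpose * A) ∘ₗ Matrix.toEuclideanLin (A.transpose * A) := by
    ext x i
    simp [Matrix.toLpLin_apply, Matrix.mulVec_mulVec]
  rw [← trace_toEuclideanLin, h, ← adjoint_comp_self_toEuclideanLin,
    LinearMap.trace_sq_adjoint_comp_self _ finrank_euclideanSpace_fin]

theorem traceNorm_transpose (A : Matrix (Fin n) (Fin n) ℝ) :
    traceNorm A.transpose = traceNorm A := by
  rw [traceNorm_eq_sum_sqrt_roots, traceNorm_eq_sum_sqrt_roots, Matrix.transpose_transpose,
    Matrix.charpoly_mul_comm]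

theorem traceNorm_submatrix (A : Matrix (Fin n) (Fin n) ℝ) (σ τ : Equiv.Perm (Fin n)) :
    traceNorm (A.submatrix σ τ) = traceNorm A := by
  have h : (A.submatrix σ τ).transpose * A.submatrix σ τ =
      Matrix.reindex τ.symm τ.symm (A.transpose * A) := by
    rw [Matrix.transpose_submatrix, Matrix.submatrix_mul_equiv]
    rfl
  rw [traceNorm_eq_sum_sqrt_roots, traceNorm_eq_sum_sqrt_roots, h, Matrix.charpoly_reindex]

theorem MatEquiv.traceNorm_eq {A B : Matrix (Fin n) (Fin n) ℝ} (h : MatEquiv A B) :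
    traceNorm A = traceNorm B := by
  obtain ⟨σ, τ, rfl | rfl⟩ := h
  · rw [traceNorm_submatrix]
  · rw [traceNorm_submatrix, traceNorm_transpose]

theorem traceNorm_nonneg (A : Matrix (Fin n) (Fin n) ℝ) : 0 ≤ traceNorm A :=
  Finset.sum_nonneg fun _ _ => LinearMap.singularValues_nonneg _ _

theorem sqrt_le_traceNorm (A : Matrix (Fin n) (Fin n) ℝ) :
    √((A.transpose * A).trace + √(2 * ((A.transpose * A).trace ^ 2 -
      (A.transpose * A * (A.transpose * A)).trace))) ≤ traceNorm A := by
  obtain ⟨h1, h2⟩ := sum_pow_four_inequality (Finset.range n)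
    (fun i => (Matrix.toEuclideanLin A).singularValues i)
    (fun _ _ => LinearMap.singularValues_nonneg _ _)
  rw [sum_sq_singularValues, sum_pow_four_singularValues] at h2
  rw [sum_sq_singularValues] at h1
  refine Real.sqrt_le_iff.2 ⟨traceNorm_nonneg A, ?_⟩
  have := Real.sqrt_le_sqrt h2
  rw [Real.sqrt_sq (sub_nonneg.2 h1)] at this
  change _ ≤ (∑ i ∈ Finset.range n, (Matrix.toEuclideanLin A).singularValues i) ^ 2
  linarith

/-- With only two singular values `x`, `y` left, the inner root is `2xy` and the outer one is `x +
y`. -/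
theorem traceNorm_eq_of_rank_le_two (hn : 2 ≤ n) (A : Matrix (Fin n) (Fin n) ℝ)
    (hA : A.rank ≤ 2) :
    traceNorm A = √((A.transpose * A).trace + √(2 * ((A.transpose * A).trace ^ 2 -
      (A.transpose * A * (A.transpose * A)).trace))) := by
  have h0 : ∀ i ∈ Finset.range n, i ∉ Finset.range 2 →
      (Matrix.toEuclideanLin A).singularValues i = 0 := by
    intro i _ hi
    rw [LinearMap.singularValues_eq_zero_iff_le_finrank_range, toEuclideanLin_eq_toLin_basisFun,
      ← Matrix.rank_eq_finrank_range_toLin]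
    rw [Finset.mem_range] at hi
    omega
  have hsub : Finset.range 2 ⊆ Finset.range n := Finset.range_mono hn
  rw [← sum_sq_singularValues, ← sum_pow_four_singularValues, traceNorm,
    ← Finset.sum_subset hsub h0,
    ← Finset.sum_subset hsub fun i hi hi' => by rw [h0 i hi hi', zero_pow two_ne_zero],
    ← Finset.sum_subset hsub fun i hi hi' => by rw [h0 i hi hi', zero_pow four_ne_zero]]
  have h1 := LinearMap.singularValues_nonneg (Matrix.toEuclideanLin A) 0
  have h2 := LinearMap.singularValues_nonneg (Matrix.toEuclideanLin A) 1
  simp only [Finset.sum_range_succ, Finset.range_zero, Finset.sum_empty, zero_add]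
  generalize (Matrix.toEuclideanLin A).singularValues 0 = x at *
  generalize (Matrix.toEuclideanLin A).singularValues 1 = y at *
  rw [show 2 * ((x ^ 2 + y ^ 2) ^ 2 - (x ^ 4 + y ^ 4)) = (2 * x * y) ^ 2 by ring,
    Real.sqrt_sq (by positivity), show x ^ 2 + y ^ 2 + 2 * x * y = (x + y) ^ 2 by ring,
    Real.sqrt_sq (by positivity)]

end TraceNorm

/-! ### Traces of a zero-one matrix as counts of cells. -/

section ZeroOne

variable {n : ℕ}

/-- The cells of a matrix with entry `1`. -/
noncomputable def onesSupport (A : Matrix (Fin n) (Fin n) ℝ) : Finset (Fin n × Fin n) :=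
  Finset.univ.filter fun x => A x.1 x.2 = 1

theorem mem_onesSupport {A : Matrix (Fin n) (Fin n) ℝ} {i j : Fin n} :
    (i, j) ∈ onesSupport A ↔ A i j = 1 := by
  simp [onesSupport]

theorem ncard_eq_card_onesSupport (A : Matrix (Fin n) (Fin n) ℝ) :
    Set.ncard {x : Fin n × Fin n | A x.1 x.2 = 1} = (onesSupport A).card := by
  rw [← Set.ncard_coe_finset]
  congr 1
  ext x
  simp [onesSupport]

theorem trace_transpose_mul_self_eq_card {A : Matrix (Fin n) (Fin n) ℝ}
    (hA : ∀ i j, A i j = 0 ∨ A i j = 1) :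
    (A.transpose * A).trace = (onesSupport A).card := by
  have h : (A.transpose * A).trace = ∑ x : Fin n × Fin n, A x.1 x.2 * A x.1 x.2 := by
    rw [Fintype.sum_prod_type, Finset.sum_comm]
    simp [Matrix.trace, Matrix.mul_apply]
  rw [h, Finset.card_eq_sum_ones, onesSupport, Finset.sum_filter]
  push_cast
  refine Finset.sum_congr rfl fun x _ => ?_
  rcases hA x.1 x.2 with h | h <;> simp [h]

/-- The squared trace counts all ordered pairs of cells of the support. The other trace counts the
pairs whose rectangle has all four corners there. -/
theorem trace_sq_sub_trace_sq_eq_card_openPairs {A : Matrix (Fin n) (Fin n) ℝ}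
    (hA : ∀ i j, A i j = 0 ∨ A i j = 1) :
    (A.transpose * A).trace ^ 2 - (A.transpose * A * (A.transpose * A)).trace =
      (openPairs (onesSupport A)).card := by
  have h1 : (A.transpose * A).trace = ∑ x : Fin n × Fin n, A x.1 x.2 * A x.1 x.2 := by
    rw [Fintype.sum_prod_type, Finset.sum_comm]
    simp [Matrix.trace, Matrix.mul_apply]
  have h2 : (A.transpose * A * (A.transpose * A)).trace =
      ∑ x : Fin n × Fin n, ∑ y : Fin n × Fin n,
        A x.1 x.2 * A x.1 y.2 * (A y.1 y.2 * A y.1 x.2) := by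
    simp only [Fintype.sum_prod_type, Matrix.trace, Matrix.mul_apply, Matrix.diag_apply,
      Matrix.transpose_apply, Finset.sum_mul_sum]
    calc _ = ∑ j : Fin n, ∑ i : Fin n, ∑ j' : Fin n, ∑ i' : Fin n,
          A i j * A i j' * (A i' j' * A i' j) :=
          Finset.sum_congr rfl fun j _ => Finset.sum_comm
      _ = ∑ i : Fin n, ∑ j : Fin n, ∑ j' : Fin n, ∑ i' : Fin n,
          A i j * A i j' * (A i' j' * A i' j) := Finset.sum_comm
      _ = _ := Finset.sum_congr rfl fun i _ => Finset.sum_congr rfl fun j _ => Finset.sum_comm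
  rw [h2, h1, sq, Finset.sum_mul_sum, ← Finset.sum_sub_distrib, openPairs, Finset.card_filter,
    Fintype.sum_prod_type (α₁ := Fin n × Fin n)]
  push_cast
  refine Finset.sum_congr rfl fun x _ => ?_
  rw [← Finset.sum_sub_distrib]
  refine Finset.sum_congr rfl fun y _ => ?_
  obtain ⟨i, j⟩ := x
  obtain ⟨i', j'⟩ := y
  simp only [mem_onesSupport]
  rcases hA i j with h | h <;> rcases hA i j' with h' | h' <;> rcases hA i' j with h'' | h'' <;>
    rcases hA i' j' with h''' | h''' <;> simp [h, h', h'', h''']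

theorem sqrt_card_le_traceNorm {A : Matrix (Fin n) (Fin n) ℝ}
    (hA : ∀ i j, A i j = 0 ∨ A i j = 1) :
    √((onesSupport A).card + √(2 * (openPairs (onesSupport A)).card)) ≤ traceNorm A := by
  rw [← trace_sq_sub_trace_sq_eq_card_openPairs hA, ← trace_transpose_mul_self_eq_card hA]
  exact sqrt_le_traceNorm A

theorem traceNorm_eq_sqrt_card (hn : 2 ≤ n) {A : Matrix (Fin n) (Fin n) ℝ}
    (hA : ∀ i j, A i j = 0 ∨ A i j = 1) (hr : A.rank ≤ 2) :
    traceNorm A = √((onesSupport A).card + √(2 * (openPairs (onesSupport A)).card)) := by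
  rw [← trace_sq_sub_trace_sq_eq_card_openPairs hA, ← trace_transpose_mul_self_eq_card hA]
  exact traceNorm_eq_of_rank_le_two hn A hr

end ZeroOne

/-! ### Moving a subset of indices to the front. -/

section Permutations

variable {n : ℕ}

theorem exists_perm_mem_iff_lt_card (S : Finset (Fin n)) :
    ∃ τ : Equiv.Perm (Fin n), ∀ j, τ j ∈ S ↔ (j : ℕ) < S.card := by
  have hS : S.card ≤ n := by simpa using S.card_le_univ
  have hc : (Finset.univ.filter fun j : Fin n => (j : ℕ) < S.card).card = S.card := by
    simpa [Fin.card_filter_val_lt] using hS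
  let e : {j : Fin n // (j : ℕ) < S.card} ≃ {j // j ∈ S} :=
    (Equiv.subtypeEquivRight (by simp)).trans (Finset.equivOfCardEq hc)
  refine ⟨e.extendSubtype, fun j => ⟨fun h => ?_, fun h => e.extendSubtype_mem j h⟩⟩
  by_contra h'
  exact e.extendSubtype_not_mem j h' h

theorem exists_perm_mem_iff_lt_card_and_eq_iff {S : Finset (Fin n)} {j₀ : Fin n} (h₀ : j₀ ∉ S) :
    ∃ τ : Equiv.Perm (Fin n), ∀ j, (τ j ∈ S ↔ (j : ℕ) < S.card) ∧
      (τ j = j₀ ↔ (j : ℕ) = S.card) := by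
  obtain ⟨τ, hτ⟩ := exists_perm_mem_iff_lt_card S
  have hS : S.card < n := by
    simpa using Finset.card_lt_univ_of_notMem h₀
  obtain ⟨l, rfl⟩ := τ.surjective j₀
  rw [hτ] at h₀
  -- Both swapped positions lie outside the initial segment that `τ` sends to `S`, so only the
  -- preimage of `j₀` is moved.
  refine ⟨(Equiv.swap ⟨S.card, hS⟩ l).trans τ, fun j => ⟨?_, ?_⟩⟩
  · rw [Equiv.trans_apply, hτ]
    rcases eq_or_ne j ⟨S.card, hS⟩ with rfl | h1
    · simpa using h₀
    rcases eq_or_ne j l with rfl | h2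
    · simpa using h₀
    rw [Equiv.swap_apply_of_ne_of_ne h1 h2]
  · rw [Equiv.trans_apply, τ.injective.eq_iff, Equiv.swap_apply_eq_iff, Equiv.swap_apply_right,
      Fin.ext_iff]

end Permutations

/-! ### Extremal matrices and the two cases. -/

section Extremal

variable {n : ℕ}

theorem onesBlock_eq_zero_or_one (a b : ℕ) (i j : Fin n) :
    onesBlock n a b i j = 0 ∨ onesBlock n a b i j = 1 := by
  by_cases h : (i : ℕ) < a ∧ (j : ℕ) < b <;> simp [onesBlock, h]

theorem twoRowStep_eq_zero_or_one (k : ℕ) (i j : Fin n) :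
    twoRowStep n k i j = 0 ∨ twoRowStep n k i j = 1 := by
  unfold twoRowStep
  simp only [Matrix.of_apply]
  split_ifs <;> simp

theorem onesSupport_onesBlock (a b : ℕ) : onesSupport (onesBlock n a b) =
    (Finset.univ.filter fun i : Fin n => (i : ℕ) < a) ×ˢ
      Finset.univ.filter fun j : Fin n => (j : ℕ) < b := by
  ext ⟨i, j⟩
  simp [mem_onesSupport, onesBlock]

theorem card_onesSupport_onesBlock {a b : ℕ} (ha : a ≤ n) (hb : b ≤ n) :
    (onesSupport (onesBlock n a b)).card = a * b := by
  rw [onesSupport_onesBlock, Finset.card_product, Fin.card_filter_val_lt, Fin.card_filter_val_lt,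
    min_eq_right ha, min_eq_right hb]

theorem rank_onesBlock_le (a b : ℕ) : (onesBlock n a b).rank ≤ 1 := by
  have h : onesBlock n a b = Matrix.vecMulVec (fun i : Fin n => if (i : ℕ) < a then (1 : ℝ) else 0)
      (fun j : Fin n => if (j : ℕ) < b then (1 : ℝ) else 0) := by
    ext i j
    simp [onesBlock, Matrix.vecMulVec_apply, ← ite_and, and_comm]
  rw [h]
  exact Matrix.rank_vecMulVec_le _ _

theorem traceNorm_onesBlock (hn : 2 ≤ n) {a b : ℕ} (ha : a ≤ n) (hb : b ≤ n) :
    traceNorm (onesBlock n a b) = √((a * b : ℕ) : ℝ) := by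
  rw [traceNorm_eq_sqrt_card hn (onesBlock_eq_zero_or_one a b)
    ((rank_onesBlock_le a b).trans one_le_two), card_onesSupport_onesBlock ha hb,
    onesSupport_onesBlock, openPairs_product]
  simp

theorem mem_onesSupport_twoRowStep {k : ℕ} {i j : Fin n} :
    (i, j) ∈ onesSupport (twoRowStep n k) ↔
      ((i : ℕ) = 0 ∧ (j : ℕ) < k + 1) ∨ ((i : ℕ) = 1 ∧ (j : ℕ) < k) := by
  simp only [mem_onesSupport, twoRowStep, Matrix.of_apply]
  split_ifs with h
  · exact iff_of_true rfl h
  · exact iff_of_false zero_ne_one h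

theorem card_onesSupport_twoRowStep (hn : 2 ≤ n) {k : ℕ} (hk : k + 1 ≤ n) :
    (onesSupport (twoRowStep n k)).card = 2 * k + 1 := by
  have h : onesSupport (twoRowStep n k) =
      ({⟨0, by omega⟩} ×ˢ Finset.univ.filter fun j : Fin n => (j : ℕ) < k + 1) ∪
      ({⟨1, by omega⟩} ×ˢ Finset.univ.filter fun j : Fin n => (j : ℕ) < k) := by
    ext ⟨i, j⟩
    simp only [mem_onesSupport_twoRowStep, Finset.mem_union, Finset.mem_product,
      Finset.mem_singleton, Finset.mem_filter, Finset.mem_univ, true_and, Fin.ext_iff]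
  rw [h, Finset.card_union_of_disjoint, Finset.card_product, Finset.card_product,
    Fin.card_filter_val_lt, Fin.card_filter_val_lt, min_eq_right hk, min_eq_right (by omega)]
  · simp only [Finset.card_singleton]
    ring
  · rw [Finset.disjoint_left]
    rintro ⟨i, j⟩
    simp only [Finset.mem_product, Finset.mem_singleton, Fin.ext_iff]
    omega

/-- The only hole in the two rows lies below the last one of the first row, so an open pair consists
of that last one and a cell of the second row, in either order. -/
theorem card_openPairs_twoRowStep_le (hn : 2 ≤ n) {k : ℕ} (hk : k + 1 ≤ n) :
    (openPairs (onesSupport (twoRowStep n k))).card ≤ 2 * k := by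
  have hc : (Finset.univ.filter fun j : Fin n => (j : ℕ) < k).card = k := by
    rw [Fin.card_filter_val_lt, min_eq_right (by omega)]
  have h : openPairs (onesSupport (twoRowStep n k)) ⊆
      ((Finset.univ.filter fun j : Fin n => (j : ℕ) < k).image
        fun j => ((⟨0, by omega⟩, ⟨k, by omega⟩), (⟨1, by omega⟩, j))) ∪
      ((Finset.univ.filter fun j : Fin n => (j : ℕ) < k).image
        fun j => ((⟨1, by omega⟩, j), (⟨0, by omega⟩, ⟨k, by omega⟩))) := by
    rintro ⟨⟨i, j⟩, i', j'⟩ hx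
    simp only [mem_openPairs, mem_onesSupport_twoRowStep] at hx
    simp only [Finset.mem_union, Finset.mem_image, Finset.mem_filter, Finset.mem_univ, true_and,
      Prod.mk.injEq, Fin.ext_iff]
    rcases hx.1 with h1 | h1
    · exact Or.inl ⟨j', by omega⟩
    · exact Or.inr ⟨j, by omega⟩
  refine (Finset.card_le_card h).trans ((Finset.card_union_le _ _).trans ?_)
  have h1 := Finset.card_image_le (s := Finset.univ.filter fun j : Fin n => (j : ℕ) < k)
    (f := fun j => (((⟨0, by omega⟩, ⟨k, by omega⟩), (⟨1, by omega⟩, j)) :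
      (Fin n × Fin n) × (Fin n × Fin n)))
  have h2 := Finset.card_image_le (s := Finset.univ.filter fun j : Fin n => (j : ℕ) < k)
    (f := fun j => (((⟨1, by omega⟩, j), (⟨0, by omega⟩, ⟨k, by omega⟩)) :
      (Fin n × Fin n) × (Fin n × Fin n)))
  rw [hc] at h1 h2
  omega

theorem rank_twoRowStep_le (k : ℕ) : (twoRowStep n k).rank ≤ 2 := by
  have h : twoRowStep n k =
      Matrix.of (fun (i : Fin n) (l : Fin 2) => if (i : ℕ) = l then (1 : ℝ) else 0) *
      Matrix.of (fun (l : Fin 2) (j : Fin n) => if (j : ℕ) + l < k + 1 then (1 : ℝ) else 0) := by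
    ext i j
    by_cases h0 : (i : ℕ) = 0
    · simp [twoRowStep, Matrix.mul_apply, h0]
    · by_cases h1 : (i : ℕ) = 1 <;> simp [twoRowStep, Matrix.mul_apply, Fin.sum_univ_two, h0, h1]
  rw [h]
  refine (Matrix.rank_mul_le_left _ _).trans ?_
  exact (Matrix.rank_le_card_width _).trans (by simp)

theorem traceNorm_twoRowStep_le (hn : 2 ≤ n) {k : ℕ} (hk : k + 1 ≤ n) :
    traceNorm (twoRowStep n k) ≤
      √(((2 * k + 1 : ℕ) : ℝ) + √(2 * (((2 * k + 1 : ℕ) : ℝ) - 1))) := by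
  rw [traceNorm_eq_sqrt_card hn (twoRowStep_eq_zero_or_one k) (rank_twoRowStep_le k),
    card_onesSupport_twoRowStep hn hk]
  have : ((openPairs (onesSupport (twoRowStep n k))).card : ℝ) ≤ 2 * k := by
    exact_mod_cast card_openPairs_twoRowStep_le hn hk
  refine Real.sqrt_le_sqrt (add_le_add_right (Real.sqrt_le_sqrt ?_) _)
  push_cast
  linarith

theorem matEquiv_onesBlock {A : Matrix (Fin n) (Fin n) ℝ} (hA : ∀ i j, A i j = 0 ∨ A i j = 1)
    {R C : Finset (Fin n)} (h : onesSupport A = R ×ˢ C) :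
    MatEquiv A (onesBlock n R.card C.card) := by
  obtain ⟨σ, hσ⟩ := exists_perm_mem_iff_lt_card R
  obtain ⟨τ, hτ⟩ := exists_perm_mem_iff_lt_card C
  refine ⟨σ, τ, Or.inl ?_⟩
  ext i j
  have hij : A (σ i) (τ j) = 1 ↔ (i : ℕ) < R.card ∧ (j : ℕ) < C.card := by
    rw [← mem_onesSupport, h, Finset.mem_product, hσ, hτ]
  rw [Matrix.submatrix_apply]
  rcases hA (σ i) (τ j) with h0 | h0
  · have : ¬ ((i : ℕ) < R.card ∧ (j : ℕ) < C.card) := by rw [← hij, h0]; norm_num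
    simp [onesBlock, h0, this]
  · simp [onesBlock, h0, hij.1 h0]

theorem exists_submatrix_eq_twoRowStep {A : Matrix (Fin n) (Fin n) ℝ}
    (hA : ∀ i j, A i j = 0 ∨ A i j = 1) {R C : Finset (Fin n)} {i₀ j₀ : Fin n} (hi₀ : i₀ ∉ R)
    (hj₀ : j₀ ∉ C) (hR : R.card = 1)
    (h : ∀ i j, A i j = 1 ↔ (i ∈ R ∧ j ∈ C) ∨ (i ∈ R ∧ j = j₀) ∨ (i = i₀ ∧ j ∈ C)) :
    ∃ σ τ : Equiv.Perm (Fin n), twoRowStep n C.card = A.submatrix σ τ := by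
  obtain ⟨σ, hσ⟩ := exists_perm_mem_iff_lt_card_and_eq_iff hi₀
  obtain ⟨τ, hτ⟩ := exists_perm_mem_iff_lt_card_and_eq_iff hj₀
  refine ⟨σ, τ, ?_⟩
  ext i j
  have hij : A (σ i) (τ j) = 1 ↔
      ((i : ℕ) = 0 ∧ (j : ℕ) < C.card + 1) ∨ ((i : ℕ) = 1 ∧ (j : ℕ) < C.card) := by
    rw [h, (hσ i).1, (hσ i).2, (hτ j).1, (hτ j).2, hR]
    omega
  rw [Matrix.submatrix_apply]
  rcases hA (σ i) (τ j) with h0 | h0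
  · rw [h0]
    rw [h0] at hij
    simp only [twoRowStep, Matrix.of_apply]
    rw [if_neg fun h' => zero_ne_one (hij.2 h')]
  · rw [h0]
    simp only [twoRowStep, Matrix.of_apply]
    rw [if_pos (hij.1 h0)]

theorem exists_matEquiv_twoRowStep {A : Matrix (Fin n) (Fin n) ℝ}
    (hA : ∀ i j, A i j = 0 ∨ A i j = 1) (h : (openPairs (onesSupport A)).Nonempty)
    (hc : (openPairs (onesSupport A)).card + 1 ≤ (onesSupport A).card) :
    ∃ k, (onesSupport A).card = 2 * k + 1 ∧ MatEquiv A (twoRowStep n k) := by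
  obtain ⟨R, C, i₀, j₀, hi₀, hj₀, hRC, hE⟩ := exists_of_card_openPairs_add_one_le h hc
  have hcard : (onesSupport A).card = R.card * C.card + R.card + C.card := by
    have : onesSupport A = (R ×ˢ C ∪ R ×ˢ {j₀}) ∪ {i₀} ×ˢ C := by
      ext ⟨i, j⟩
      simp only [hE, Finset.mem_union, Finset.mem_product, Finset.mem_singleton, or_assoc]
    rw [this, Finset.card_union_of_disjoint, Finset.card_union_of_disjoint]
    · simp
    all_goals
      rw [Finset.disjoint_left]
      rintro ⟨i, j⟩
      simp only [Finset.mem_union, Finset.mem_product, Finset.mem_singleton]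
      grind
  simp only [mem_onesSupport] at hE
  rcases hRC with h1 | h1
  · obtain ⟨σ, τ, e⟩ := exists_submatrix_eq_twoRowStep hA hi₀ hj₀ h1 hE
    exact ⟨C.card, by rw [hcard, h1]; ring, σ, τ, Or.inl e⟩
  -- The description of the support is symmetric in rows and columns, so a single full column
  -- reduces to a single full row by transposing.
  · obtain ⟨σ, τ, e⟩ := exists_submatrix_eq_twoRowStep (A := A.transpose) (fun i j => hA j i)
      hj₀ hi₀ h1 (fun i j => by rw [Matrix.transpose_apply, hE]; tauto)
    exact ⟨R.card, by rw [hcard, h1]; ring, σ, τ, Or.inr e⟩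

theorem psi_eq_of_isLeast {m : ℕ} {v : ℝ} (h : IsLeast (traceNorm '' zeroOneMatrices n m) v) :
    psi n m = v :=
  h.csInf_eq

theorem exists_card_eq_mul_of_openPairs_eq_empty {A : Matrix (Fin n) (Fin n) ℝ}
    (hA : ∀ i j, A i j = 0 ∨ A i j = 1) (h : openPairs (onesSupport A) = ∅) :
    ∃ a b, a ≤ n ∧ b ≤ n ∧ (onesSupport A).card = a * b ∧ MatEquiv A (onesBlock n a b) := by
  have hE := eq_product_of_openPairs_eq_empty h
  refine ⟨((onesSupport A).image Prod.fst).card, ((onesSupport A).image Prod.snd).card, ?_, ?_, ?_,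
    matEquiv_onesBlock hA hE⟩
  · simpa using ((onesSupport A).image Prod.fst).card_le_univ
  · simpa using ((onesSupport A).image Prod.snd).card_le_univ
  · conv_lhs => rw [hE]
    rw [Finset.card_product]

theorem openPairs_nonempty_of_prime {A : Matrix (Fin n) (Fin n) ℝ}
    (hA : ∀ i j, A i j = 0 ∨ A i j = 1) (hp : (onesSupport A).card.Prime)
    (hn : n < (onesSupport A).card) : (openPairs (onesSupport A)).Nonempty := by
  rw [Finset.nonempty_iff_ne_empty]
  intro h
  obtain ⟨a, b, ha, hb, hab, -⟩ := exists_card_eq_mul_of_openPairs_eq_empty hA h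
  -- One side would be 1 and the other the whole prime, which exceeds `n`.
  rcases (Nat.prime_mul_iff.1 (hab ▸ hp)) with ⟨-, h1⟩ | ⟨-, h1⟩ <;> rw [h1] at hab <;> omega

theorem sqrt_le_traceNorm_of_openPairs_nonempty {A : Matrix (Fin n) (Fin n) ℝ}
    (hA : ∀ i j, A i j = 0 ∨ A i j = 1) (h : (openPairs (onesSupport A)).Nonempty) :
    √((onesSupport A).card + √(2 * ((onesSupport A).card - 1))) ≤ traceNorm A := by
  refine le_trans (Real.sqrt_le_sqrt (add_le_add_right (Real.sqrt_le_sqrt ?_) _))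
    (sqrt_card_le_traceNorm hA)
  have : ((onesSupport A).card : ℝ) ≤ (openPairs (onesSupport A)).card + 1 := by
    exact_mod_cast card_le_card_openPairs_add_one h
  linarith

theorem card_openPairs_add_one_le_of_traceNorm_le {A : Matrix (Fin n) (Fin n) ℝ}
    (hA : ∀ i j, A i j = 0 ∨ A i j = 1) (h1 : 1 ≤ (onesSupport A).card)
    (h : traceNorm A ≤ √((onesSupport A).card + √(2 * ((onesSupport A).card - 1)))) :
    (openPairs (onesSupport A)).card + 1 ≤ (onesSupport A).card := by
  have h2 : (0 : ℝ) ≤ (onesSupport A).card - 1 := by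
    rw [sub_nonneg]
    exact_mod_cast h1
  have h3 := (sqrt_card_le_traceNorm hA).trans h
  rw [Real.sqrt_le_sqrt_iff (by positivity), add_le_add_iff_left,
    Real.sqrt_le_sqrt_iff (by positivity)] at h3
  have : ((openPairs (onesSupport A)).card : ℝ) + 1 ≤ (onesSupport A).card := by linarith
  exact_mod_cast this

theorem openPairs_eq_empty_of_traceNorm_le {A : Matrix (Fin n) (Fin n) ℝ}
    (hA : ∀ i j, A i j = 0 ∨ A i j = 1) (h : traceNorm A ≤ √((onesSupport A).card : ℝ)) :
    openPairs (onesSupport A) = ∅ := by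
  have h3 := (sqrt_card_le_traceNorm hA).trans h
  rw [Real.sqrt_le_sqrt_iff (by positivity), add_le_iff_nonpos_right, Real.sqrt_le_left le_rfl] at h3
  rw [← Finset.card_eq_zero]
  have : ((openPairs (onesSupport A)).card : ℝ) ≤ 0 := by linarith
  exact_mod_cast le_antisymm this (Nat.cast_nonneg _)

theorem mem_zeroOneMatrices_iff {m : ℕ} {A : Matrix (Fin n) (Fin n) ℝ} :
    A ∈ zeroOneMatrices n m ↔ (∀ i j, A i j = 0 ∨ A i j = 1) ∧ (onesSupport A).card = m := by
  rw [← ncard_eq_card_onesSupport]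
  rfl

theorem isLeast_traceNorm_of_prime {m : ℕ} (hn : 2 ≤ n) (hnm : n < m) (hm : m ≤ 2 * n)
    (hp : m.Prime) :
    IsLeast (traceNorm '' zeroOneMatrices n m) (√((m : ℝ) + √(2 * ((m : ℝ) - 1)))) := by
  have hlow : ∀ A ∈ zeroOneMatrices n m, √((m : ℝ) + √(2 * ((m : ℝ) - 1))) ≤ traceNorm A := by
    intro A hA
    obtain ⟨h01, rfl⟩ := mem_zeroOneMatrices_iff.1 hA
    exact sqrt_le_traceNorm_of_openPairs_nonempty h01 (openPairs_nonempty_of_prime h01 hp hnm)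
  obtain ⟨k, rfl⟩ := hp.odd_of_ne_two (by omega)
  have hk : k + 1 ≤ n := by omega
  have hmem : twoRowStep n k ∈ zeroOneMatrices n (2 * k + 1) := mem_zeroOneMatrices_iff.2
    ⟨twoRowStep_eq_zero_or_one k, card_onesSupport_twoRowStep hn hk⟩
  refine ⟨⟨_, hmem, le_antisymm (traceNorm_twoRowStep_le hn hk) (hlow _ hmem)⟩, ?_⟩
  rintro _ ⟨A, hA, rfl⟩
  exact hlow A hA

theorem isLeast_traceNorm_of_not_prime {m : ℕ} (hn : 2 ≤ n) (hnm : n < m) (hm : m ≤ 2 * n)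
    (hp : ¬ m.Prime) :
    IsLeast (traceNorm '' zeroOneMatrices n m) (√(m : ℝ)) := by
  constructor
  · obtain ⟨a, ha, ha2, ham⟩ := Nat.exists_dvd_of_not_prime2 (by omega) hp
    obtain ⟨b, rfl⟩ := ha
    have hb : 2 ≤ b := by
      by_contra hb
      interval_cases b <;> omega
    -- Both factors are at least 2 and their product is at most `2n`, so each is at most `n`.
    have han : a ≤ n := by nlinarith
    have hbn : b ≤ n := by nlinarith
    exact ⟨onesBlock n a b, mem_zeroOneMatrices_iff.2
      ⟨onesBlock_eq_zero_or_one a b, card_onesSupport_onesBlock han hbn⟩,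
      traceNorm_onesBlock hn han hbn⟩
  · rintro _ ⟨A, hA, rfl⟩
    obtain ⟨h01, rfl⟩ := mem_zeroOneMatrices_iff.1 hA
    exact (Real.sqrt_le_sqrt (le_add_of_nonneg_right (Real.sqrt_nonneg _))).trans
      (sqrt_card_le_traceNorm h01)

end Extremal

/-- Since the minimum is attained, the equivalence for prime `m` also yields that `m` is odd.
Positivity of `a` and `b` is implied by `a * b = m > 0`. -/
theorem theorem1 (n m : ℕ) (hn : 2 ≤ n) (hnm : n < m) (hm : m ≤ 2 * n) :
    IsLeast (traceNorm '' zeroOneMatrices n m) (psi n m) ∧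
    (m.Prime →
      psi n m = Real.sqrt ((m : ℝ) + Real.sqrt (2 * ((m : ℝ) - 1))) ∧
      ∀ A ∈ zeroOneMatrices n m,
        (traceNorm A = psi n m ↔ ∃ k : ℕ, m = 2 * k + 1 ∧ MatEquiv A (twoRowStep n k))) ∧
    (¬ m.Prime →
      psi n m = Real.sqrt (m : ℝ) ∧
      ∀ A ∈ zeroOneMatrices n m,
        (traceNorm A = psi n m ↔
          ∃ a b : ℕ, a ≤ n ∧ b ≤ n ∧ m = a * b ∧ MatEquiv A (onesBlock n a b))) := by
  refine ⟨?_, fun hp => ?_, fun hp => ?_⟩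
  · by_cases hp : m.Prime
    · have h := isLeast_traceNorm_of_prime hn hnm hm hp
      rwa [psi_eq_of_isLeast h]
    · have h := isLeast_traceNorm_of_not_prime hn hnm hm hp
      rwa [psi_eq_of_isLeast h]
  · have h := isLeast_traceNorm_of_prime hn hnm hm hp
    rw [psi_eq_of_isLeast h]
    refine ⟨rfl, fun A hAm => ⟨fun hA => ?_, ?_⟩⟩
    · obtain ⟨h01, rfl⟩ := mem_zeroOneMatrices_iff.1 hAm
      exact exists_matEquiv_twoRowStep h01 (openPairs_nonempty_of_prime h01 hp hnm)
        (card_openPairs_add_one_le_of_traceNorm_le h01 hp.one_le hA.le)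
    · rintro ⟨k, rfl, hk⟩
      refine le_antisymm ?_ (h.2 ⟨A, hAm, rfl⟩)
      rw [hk.traceNorm_eq]
      exact traceNorm_twoRowStep_le hn (by omega)
  · have h := isLeast_traceNorm_of_not_prime hn hnm hm hp
    rw [psi_eq_of_isLeast h]
    refine ⟨rfl, fun A hAm => ⟨fun hA => ?_, ?_⟩⟩
    · obtain ⟨h01, rfl⟩ := mem_zeroOneMatrices_iff.1 hAm
      exact exists_card_eq_mul_of_openPairs_eq_empty h01
        (openPairs_eq_empty_of_traceNorm_le h01 hA.le)
    · rintro ⟨a, b, ha, hb, rfl, hab⟩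
      rw [hab.traceNorm_eq, traceNorm_onesBlock hn ha hb]
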